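/- Let $(M,g)$ be a smooth Lorentzian manifold of dimension $n+1$, with $g$ of signature $(-,+,\dots,+)$, that admits a spacetime convex function, i.e. a smooth function $f:M\to\mathbb{R}$ whose Hessian $\nabla_\mu\nabla_\nu f$ has Lorentzian signature $(-,+,\dots,+)$ everywhere and for which there is a constant $c>0$ with $V^\mu V^\nu\nabla_\mu\nabla_\nu f\ge c\,g_{\mu\nu}V^\mu V^\nu$ for all tangent vectors $V\in TM$. Let $\Sigma$ be a smooth spacelike hypersurface of $M$ (an $n$-dimensional manifold without boundary, immersed in $M$, with positive definite induced metric $h_{ij}$) whose second fundamental form $K_{ij}$, taken with respect to the unit normals of $\Sigma$, vanishes identically. Then the Riemannian manifold $(\Sigma,h)$ admits no closed geodesic (no non-constant periodic geodesic $\gamma:\mathbb{R}\to\Sigma$) and no closed minimal two-surface (there is no non-empty compact two-dimensional manifold $S$ without boundary with a smooth immersion $S\to\Sigma$ whose mean curvature vector with respect to $h$ vanishes identically). -/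

import Mathlib

set_option maxSynthPendingDepth 3

open scoped Manifold ContDiff

noncomputable section

namespace SpacetimeConvex

/-! ### Bilinear forms of Lorentzian signature -/

section LinearAlgebra

variable {V : Type*} [TopologicalSpace V] [AddCommGroup V] [Module ℝ V]

/-- The quadratic form `v ↦ B v v` of a bilinear form `B`. -/
def toQuadratic (B : V →L[ℝ] V →L[ℝ] ℝ) : QuadraticForm ℝ V :=
  LinearMap.BilinMap.toQuadraticMap (ContinuousLinearMap.coeLM ℝ ∘ₗ B.toLinearMap)

theorem toQuadratic_apply (B : V →L[ℝ] V →L[ℝ] ℝ) (v : V) : toQuadratic B v = B v v := rfl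

/-- `B` is symmetric of signature `(-, +, …, +)`: one minus sign, and plus signs for all the
remaining dimensions. -/
structure IsLorentzian (B : V →L[ℝ] V →L[ℝ] ℝ) : Prop where
  symm : ∀ v w, B v w = B w v
  sigNeg_eq : sigNeg (toQuadratic B) = 1
  sigPos_eq : sigPos (toQuadratic B) + 1 = Module.finrank ℝ V

end LinearAlgebra

/-! ### Christoffel symbols in an open set of a vector space -/

section Christoffel

variable {E : Type*} [NormedAddCommGroup E] [NormedSpace ℝ E]

/-- Christoffel symbols of the first kind,
`Γ(v, w; z) = ½ (∂_v G(w, z) + ∂_w G(v, z) - ∂_z G(v, w))`, see `christoffelFirst_apply`. -/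
def christoffelFirst (G : E → E →L[ℝ] E →L[ℝ] ℝ) (y : E) : E →L[ℝ] E →L[ℝ] E →L[ℝ] ℝ :=
  let D : E →L[ℝ] E →L[ℝ] E →L[ℝ] ℝ := fderiv ℝ G y
  let D' : E →L[ℝ] E →L[ℝ] E →L[ℝ] ℝ := D.flip
  let D'' : E →L[ℝ] E →L[ℝ] E →L[ℝ] ℝ :=
    (ContinuousLinearMap.flipₗᵢ ℝ E E ℝ).toContinuousLinearEquiv.toContinuousLinearMap.comp D.flip
  (1 / 2 : ℝ) • (D + D' - D'')

theorem christoffelFirst_apply (G : E → E →L[ℝ] E →L[ℝ] ℝ) (y v w z : E) :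
    christoffelFirst G y v w z =
      (1 / 2) * (fderiv ℝ G y v w z + fderiv ℝ G y w v z - fderiv ℝ G y z v w) := by
  simp [christoffelFirst]

/-- Christoffel symbols `Γ(v, w)` of the second kind: `G (Γ(v, w), z) = Γ(v, w; z)`, that is,
the index is raised by the inverse of `u ↦ G(u, ·)`. -/
def christoffel (G : E → E →L[ℝ] E →L[ℝ] ℝ) (y : E) : E →L[ℝ] E →L[ℝ] E :=
  (ContinuousLinearMap.compL ℝ E (E →L[ℝ] ℝ) E (G y).inverse).comp (christoffelFirst G y)

theorem christoffel_apply (G : E → E →L[ℝ] E →L[ℝ] ℝ) (y v w : E) :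
    christoffel G y v w = (G y).inverse (christoffelFirst G y v w) := rfl

end Christoffel

/-! ### Metrics on manifolds and their Levi-Civita derivatives

Tangent vectors at `x` are, as in Mathlib, identified with their coordinates in the preferred chart
`extChartAt 𝓘(ℝ, E) x`. All the tensors below are computed at `x` in this chart. -/

section Manifold

variable {E : Type*} [NormedAddCommGroup E] [NormedSpace ℝ E]
  {M : Type*} [TopologicalSpace M] [ChartedSpace E M]
  {F : Type*} [NormedAddCommGroup F] [NormedSpace ℝ F]
  {N : Type*} [TopologicalSpace N] [ChartedSpace F N]

variable (E M) in
/-- A field of bilinear forms on the tangent spaces of `M`. -/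
abbrev BilinearField : Type _ :=
  ∀ x : M, TangentSpace 𝓘(ℝ, E) x →L[ℝ] TangentSpace 𝓘(ℝ, E) x →L[ℝ] ℝ

variable (E M) in
/-- A smooth Lorentzian metric, of signature `(-, +, …, +)`, on the manifold `M`. -/
structure LorentzianMetric [IsManifold 𝓘(ℝ, E) ∞ M] where
  form : BilinearField E M
  isLorentzian : ∀ x, IsLorentzian (form x)
  contMDiff : ContMDiff 𝓘(ℝ, E) (𝓘(ℝ, E).prod 𝓘(ℝ, E →L[ℝ] E →L[ℝ] ℝ)) ∞
    (fun x ↦ Bundle.TotalSpace.mk' (E →L[ℝ] E →L[ℝ] ℝ)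
      (E := fun x : M ↦ TangentSpace 𝓘(ℝ, E) x →L[ℝ] TangentSpace 𝓘(ℝ, E) x →L[ℝ] ℝ) x (form x))

/-- The pull-back `(u^* g)_x (v, w) = g_{u x} (du v, du w)`. -/
def pullback (g : BilinearField E M) (u : N → M) : BilinearField F N := fun x ↦
  ContinuousLinearMap.bilinearComp (E := E) (F := E) (E' := F) (F' := F) (g (u x))
    (mfderiv 𝓘(ℝ, F) 𝓘(ℝ, E) u x) (mfderiv 𝓘(ℝ, F) 𝓘(ℝ, E) u x)

theorem pullback_apply (g : BilinearField E M) (u : N → M) (x : N) (v w : TangentSpace 𝓘(ℝ, F) x) :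
    pullback g u x v w =
      g (u x) (mfderiv 𝓘(ℝ, F) 𝓘(ℝ, E) u x v) (mfderiv 𝓘(ℝ, F) 𝓘(ℝ, E) u x w) := rfl

/-- The components of `g` in the preferred chart at `x₀`, as a function of the coordinates. -/
def formInChart (g : BilinearField E M) (x₀ : M) : E → E →L[ℝ] E →L[ℝ] ℝ :=
  pullback g (extChartAt 𝓘(ℝ, E) x₀).symm

/-- The Christoffel symbols of `g` at `x`, in the preferred chart at `x`. -/
def christoffelAt (g : BilinearField E M) (x : M) : E →L[ℝ] E →L[ℝ] E :=
  christoffel (formInChart g x) (extChartAt 𝓘(ℝ, E) x x)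

/-- The Hessian `∇_μ ∇_ν f = ∂_μ ∂_ν f - Γ^λ_μν ∂_λ f`. -/
def hessian (g : BilinearField E M) (f : M → ℝ) : BilinearField E M := fun x ↦
  let fc : E → ℝ := f ∘ (extChartAt 𝓘(ℝ, E) x).symm
  let y : E := extChartAt 𝓘(ℝ, E) x x
  (fderiv ℝ (fderiv ℝ fc) y -
    (ContinuousLinearMap.compL ℝ E E ℝ (fderiv ℝ fc y)).comp (christoffelAt g x) :
      E →L[ℝ] E →L[ℝ] ℝ)

/-- For a map `u : N → M` into a manifold with metric `g`, the derivative `∇_v (du w)` along `u`,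
where `∇` is the Levi-Civita connection of `g` and `w` is extended with constant coordinates:
`∂_i ∂_j u^μ + Γ^μ_αβ ∂_i u^α ∂_j u^β`. -/
def covSecondDeriv (g : BilinearField E M) (u : N → M) (x : N) : F →L[ℝ] F →L[ℝ] E :=
  let uc : F → E := extChartAt 𝓘(ℝ, E) (u x) ∘ u ∘ (extChartAt 𝓘(ℝ, F) x).symm
  let y : F := extChartAt 𝓘(ℝ, F) x x
  fderiv ℝ (fderiv ℝ uc) y +
    (christoffelAt g (u x)).bilinearComp (fderiv ℝ uc y) (fderiv ℝ uc y)

/-! ### Spacetime convex functions -/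

/-- `f` is a spacetime convex function: it is smooth, its Hessian has Lorentzian signature, and
`∇_μ ∇_ν f V^μ V^ν ≥ c g_μν V^μ V^ν` for all tangent vectors `V`, with a constant `c > 0`. -/
structure IsSpacetimeConvex [IsManifold 𝓘(ℝ, E) ∞ M] (g : LorentzianMetric E M) (f : M → ℝ) :
    Prop where
  smooth : ContMDiff 𝓘(ℝ, E) 𝓘(ℝ, ℝ) ∞ f
  isLorentzian_hessian : ∀ x, IsLorentzian (hessian g.form f x)
  bound : ∃ c : ℝ, 0 < c ∧ ∀ (x : M) (V : TangentSpace 𝓘(ℝ, E) x),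
    c * g.form x V V ≤ hessian g.form f x V V

/-! ### Submanifolds, given by immersions -/

/-- `u` is smooth and the induced form `u^* g` is positive definite; in particular `u` is an
immersion. -/
structure IsSpacelikeImmersion (g : BilinearField E M) (u : N → M) : Prop where
  smooth : ContMDiff 𝓘(ℝ, F) 𝓘(ℝ, E) ∞ u
  pos : ∀ (x : N) (v : TangentSpace 𝓘(ℝ, F) x), v ≠ 0 → 0 < pullback g u x v v

/-- `ν` is a unit timelike normal of `u : N → M` at `x`. -/
structure IsUnitTimelikeNormal (g : BilinearField E M) (u : N → M) (x : N)
    (ν : TangentSpace 𝓘(ℝ, E) (u x)) : Prop where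
  normal : ∀ v : TangentSpace 𝓘(ℝ, F) x, g (u x) ν (mfderiv 𝓘(ℝ, F) 𝓘(ℝ, E) u x v) = 0
  unit : g (u x) ν ν = -1

/-- The second fundamental form `K_ij` with respect to the unit normal `ν`:
`K(v, w) = g(∇_v ν, du w) = - g(ν, ∇_v (du w))`. -/
def extrinsicCurvature (g : BilinearField E M) (u : N → M) (x : N)
    (ν : TangentSpace 𝓘(ℝ, E) (u x)) (v w : TangentSpace 𝓘(ℝ, F) x) : ℝ :=
  - g (u x) ν (covSecondDeriv (E := E) (F := F) g u x v w : E)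

/-- The vector-valued second fundamental form of an immersion `u` into a manifold with metric `g`:
`II(v, w) = ∇_v (du w) - du (∇'_v w)`, with `∇'` the Levi-Civita connection of `u^* g`. -/
def secondFundamentalForm (g : BilinearField E M) (u : N → M) (x : N)
    (v w : TangentSpace 𝓘(ℝ, F) x) : TangentSpace 𝓘(ℝ, E) (u x) :=
  let A : E := covSecondDeriv (F := F) g u x v w
  let B : E := mfderiv 𝓘(ℝ, F) 𝓘(ℝ, E) u x (christoffelAt (pullback (F := F) g u) x v w)
  (A - B : E)

/-- `u` is a minimal immersion: a smooth immersion with positive definite induced metric whose mean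
curvature vector, the trace of `II` over any orthonormal basis for the induced metric, vanishes. -/
structure IsMinimalImmersion (g : BilinearField E M) (u : N → M) : Prop
    extends IsSpacelikeImmersion (F := F) g u where
  trace_eq_zero : ∀ (x : N) (e : Fin (Module.finrank ℝ F) → TangentSpace 𝓘(ℝ, F) x),
    (∀ i j, pullback g u x (e i) (e j) = if i = j then 1 else 0) →
      ∑ i, secondFundamentalForm (F := F) g u x (e i) (e i) = 0

/-- `γ` is an (affinely parametrized) geodesic defined on all of `ℝ`: `∇_{γ'} γ' = 0`. -/
structure IsGeodesic (g : BilinearField E M) (γ : ℝ → M) : Prop where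
  smooth : ContMDiff 𝓘(ℝ, ℝ) 𝓘(ℝ, E) ∞ γ
  eqn : ∀ t, covSecondDeriv (F := ℝ) g γ t 1 1 = 0

/-- `γ` is a closed geodesic: a non-constant periodic geodesic. -/
structure IsClosedGeodesic (g : BilinearField E M) (γ : ℝ → M) : Prop
    extends IsGeodesic (E := E) g γ where
  periodic : ∃ T : ℝ, 0 < T ∧ Function.Periodic γ T
  nonconstant : ∃ s t, γ s ≠ γ t

end Manifold

end SpacetimeConvex

end

/-! Vanishing extrinsic curvature makes the hypersurface totally geodesic. Its vector-valued second
fundamental form is always normal (`secondFundamentalForm_orthogonal`), a nonzero normal vector is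
timelike (`IsLorentzian.neg_of_orthogonal`), and pairing with the corresponding unit normal would
detect it (`secondFundamentalForm_eq_zero`).

Write `h` for the induced metric. For a smooth map `u` into the hypersurface, `∇ d(ι ∘ u)` is then
the image under `dι` of the intrinsic `∇ du`. The chain rule and the convexity bound give `D²(f ∘ ι
∘ u)(v, v) ≥ c h(du v, du v) + d(f ∘ ι)(∇_v du v)`, which is
`IsSpacetimeConvex.exists_le_fderiv_fderiv`: the restriction of `f` is strictly convex for `h`.

Along a closed geodesic the last term vanishes, so `f` is periodic with nonnegative second
derivative, hence constant; the inequality then forces zero velocity. On a closed minimal surface,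
consider a maximum of `f`: the first derivative vanishes, so `∇_v du v` may be replaced by the
second fundamental form. Summing over an orthonormal basis removes it by minimality and leaves `2c ≤
0`.

Tensors at a point are computed in the preferred chart there, so the pointwise identities are
checked at chart centres, where the chart has identity differential. -/

noncomputable section

namespace SpacetimeConvex

/-! ### Lorentzian linear algebra and raising of indices -/

section LinearAlgebra

/-- A positive definite symmetric form has an orthonormal basis. -/
theorem exists_orthonormal_of_pos {V : Type*} [AddCommGroup V] [Module ℝ V]
    [FiniteDimensional ℝ V] (B : V →ₗ[ℝ] V →ₗ[ℝ] ℝ) (hsymm : ∀ v w, B v w = B w v)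
    (hpos : ∀ v, v ≠ 0 → 0 < B v v) :
    ∃ e : Fin (Module.finrank ℝ V) → V, ∀ i j, B (e i) (e j) = if i = j then 1 else 0 := by
  -- The form itself becomes the inner product; this is why `V` is a bare module, with no norm that
  -- could conflict with it.
  let core : InnerProductSpace.Core ℝ V :=
    { inner := fun v w ↦ B v w
      conj_inner_symm := fun v w ↦ hsymm w v
      re_inner_nonneg := fun v ↦ by
        by_cases h : v = 0
        · simp [h]
        · exact (hpos v h).le
      add_left := fun u v w ↦ by simp
      smul_left := fun u v r ↦ by simp
      definite := fun v h ↦ by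
        by_contra hv
        exact (hpos v hv).ne' h }
  let _ : NormedAddCommGroup V := core.toNormedAddCommGroup
  let _ : InnerProductSpace ℝ V := InnerProductSpace.ofCore core.toCore
  exact ⟨stdOrthonormalBasis ℝ V, fun i j ↦
    orthonormal_iff_ite.mp (stdOrthonormalBasis ℝ V).orthonormal i j⟩

variable {E : Type*} [NormedAddCommGroup E] [NormedSpace ℝ E] [FiniteDimensional ℝ E]
  {F : Type*} [NormedAddCommGroup F] [NormedSpace ℝ F] [FiniteDimensional ℝ F]

/-- A bilinear form of Lorentzian signature is nondegenerate. -/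
theorem IsLorentzian.eq_zero_of_apply_eq_zero {B : E →L[ℝ] E →L[ℝ] ℝ} (hB : IsLorentzian B) {v : E}
    (hv : ∀ w, B v w = 0) : v = 0 := by
  have h := QuadraticForm.sigPos_add_sigNeg_add_radical (Q := toQuadratic B)
  rw [hB.sigNeg_eq, hB.sigPos_eq] at h
  -- The signature already exhausts the dimension, so nothing is left for the radical.
  have h0 : (toQuadratic B).radical = ⊥ := Submodule.finrank_eq_zero.mp (by omega)
  have hmem : v ∈ (toQuadratic B).radical := by
    rw [QuadraticMap.mem_radical_iff']
    refine ⟨hv v, fun w ↦ ?_⟩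
    simp only [toQuadratic_apply, map_add, add_apply, hv, hB.symm w v]
    ring
  rw [h0] at hmem
  simpa using hmem

/-- In a Lorentzian vector space, nonzero vectors orthogonal to a spacelike hyperplane are
timelike. -/
theorem IsLorentzian.neg_of_orthogonal {B : E →L[ℝ] E →L[ℝ] ℝ} (hB : IsLorentzian B) {L : F →L[ℝ] E}
    (hL : ∀ v, v ≠ 0 → 0 < B (L v) (L v))
    (hdim : Module.finrank ℝ E = Module.finrank ℝ F + 1) {w : E} (hw : w ≠ 0)
    (horth : ∀ v, B w (L v) = 0) : B w w < 0 := by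
  by_contra! hww
  have hinj : Function.Injective L.toLinearMap := by
    rw [← LinearMap.ker_eq_bot, LinearMap.ker_eq_bot']
    intro v hv
    by_contra hv0
    have := hL v hv0
    simp [show L v = 0 from hv] at this
  have hwL : w ∉ LinearMap.range L.toLinearMap := by
    rintro ⟨v, rfl⟩
    have hv : v ≠ 0 := by rintro rfl; simp at hw
    exact (hL v hv).ne' (horth v)
  have htop : LinearMap.range L.toLinearMap ⊔ Submodule.span ℝ {w} = ⊤ := by
    apply Submodule.eq_top_of_finrank_eq
    have h1 := Submodule.finrank_sup_add_finrank_inf_eq (LinearMap.range L.toLinearMap)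
      (Submodule.span ℝ {w})
    have h2 : LinearMap.range L.toLinearMap ⊓ Submodule.span ℝ {w} = ⊥ :=
      disjoint_iff.mp ((Submodule.disjoint_span_singleton' hw).mpr hwL)
    rw [h2, finrank_bot, finrank_span_singleton hw, LinearMap.finrank_range_of_inj hinj] at h1
    omega
  -- If `w` were not timelike, `B` would be positive semidefinite on hyperplane plus line, which is
  -- the whole space; the negative direction counted by `sigNeg` contradicts this.
  have hnn : ∀ x, 0 ≤ B x x := by
    intro x
    obtain ⟨_, ⟨v, rfl⟩, y, hy, rfl⟩ := Submodule.mem_sup.mp (htop ▸ Submodule.mem_top (x := x))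
    obtain ⟨a, rfl⟩ := Submodule.mem_span_singleton.mp hy
    have hv : 0 ≤ B (L v) (L v) := by
      by_cases h : v = 0
      · simp [h]
      · exact (hL v h).le
    have h' : B (L v) w = 0 := by rw [hB.symm, horth]
    have : B (L v + a • w) (L v + a • w) = B (L v) (L v) + a * a * B w w := by
      simp [horth, h']; ring
    change 0 ≤ B (L v + a • w) (L v + a • w)
    rw [this]
    exact add_nonneg hv (mul_nonneg (mul_self_nonneg a) hww)
  obtain ⟨V, hV, hneg⟩ := exists_finrank_eq_sigNeg_and_negDef (toQuadratic B)
  rw [hB.sigNeg_eq] at hV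
  have : Nontrivial V := Module.nontrivial_of_finrank_pos (R := ℝ) (by omega)
  obtain ⟨x, hx⟩ := exists_ne (0 : V)
  have h1 := hneg x hx
  have h2 := hnn x
  simp [QuadraticMap.restrict_apply, toQuadratic_apply] at h1
  linarith

/-- A nondegenerate bilinear form raises indices. -/
theorem apply_inverse_of_nondegenerate {B : E →L[ℝ] E →L[ℝ] ℝ}
    (hB : ∀ v, (∀ w, B v w = 0) → v = 0) (α : E →L[ℝ] ℝ) : B (B.inverse α) = α := by
  have hinj : Function.Injective B.toLinearMap := by
    rw [← LinearMap.ker_eq_bot, LinearMap.ker_eq_bot']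
    intro v hv
    exact hB v fun w ↦ by
      have : B v = 0 := hv
      simp [this]
  -- `inverse` has the default value zero on non-invertible maps; equality of dimensions upgrades
  -- injectivity to invertibility.
  have hdim : Module.finrank ℝ E = Module.finrank ℝ (E →L[ℝ] ℝ) := by
    rw [← (LinearMap.toContinuousLinearMap (𝕜 := ℝ) (E := E) (F' := ℝ)).finrank_eq]
    exact (Subspace.dual_finrank_eq (K := ℝ) (V := E)).symm
  let e : E ≃L[ℝ] (E →L[ℝ] ℝ) :=
    (LinearEquiv.ofInjectiveOfFinrankEq B.toLinearMap hinj hdim).toContinuousLinearEquiv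
  have he : B = (e : E →L[ℝ] E →L[ℝ] ℝ) := by
    ext v w
    rfl
  conv_lhs => rw [he, ContinuousLinearMap.inverse_equiv]
  exact e.apply_symm_apply α

/-- Pairing with the metric undoes the raised index, so later comparisons of connections need only
first-kind symbols. -/
theorem apply_christoffel {G : E → E →L[ℝ] E →L[ℝ] ℝ} {y : E}
    (hG : ∀ v, (∀ w, G y v w = 0) → v = 0) (v w z : E) :
    G y (christoffel G y v w) z = christoffelFirst G y v w z := by
  rw [christoffel_apply, apply_inverse_of_nondegenerate hG]

end LinearAlgebra

/-! ### Second derivatives and Christoffel symbols under composition -/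

section Calculus

variable {E : Type*} [NormedAddCommGroup E] [NormedSpace ℝ E]
  {F : Type*} [NormedAddCommGroup F] [NormedSpace ℝ F]
  {G : Type*} [NormedAddCommGroup G] [NormedSpace ℝ G]

/-- Chain rule for second derivatives. -/
theorem fderiv_fderiv_comp {f : E → G} {u : F → E} {y : F} (hf : ContDiffAt ℝ ∞ f (u y))
    (hu : ContDiffAt ℝ ∞ u y) (v w : F) :
    fderiv ℝ (fderiv ℝ (f ∘ u)) y v w =
      fderiv ℝ (fderiv ℝ f) (u y) (fderiv ℝ u y v) (fderiv ℝ u y w) +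
        fderiv ℝ f (u y) (fderiv ℝ (fderiv ℝ u) y v w) := by
  -- The first-order chain rule is needed on a neighbourhood, since it is differentiated once more.
  have hev : fderiv ℝ (f ∘ u) =ᶠ[nhds y] fun x ↦ (fderiv ℝ f (u x)).comp (fderiv ℝ u x) := by
    have h1 := (hf.of_le (m := 1) (mod_cast le_top)).eventually (by simp)
    have h2 := (hu.of_le (m := 1) (mod_cast le_top)).eventually (by simp)
    filter_upwards [hu.continuousAt.eventually h1, h2] with x hx1 hx2
    exact fderiv_comp x (hx1.differentiableAt (by simp)) (hx2.differentiableAt (by simp))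
  have hf' : DifferentiableAt ℝ (fderiv ℝ f) (u y) :=
    (hf.fderiv_right (m := ∞) le_rfl).differentiableAt (by simp)
  have hu' : DifferentiableAt ℝ (fderiv ℝ u) y :=
    (hu.fderiv_right (m := ∞) le_rfl).differentiableAt (by simp)
  have hud : DifferentiableAt ℝ u y := hu.differentiableAt (by simp)
  have h := (hf'.hasFDerivAt.comp y hud.hasFDerivAt).clm_comp hu'.hasFDerivAt
  rw [hev.fderiv_eq]
  erw [h.fderiv]
  simp [add_comm]

/-- Christoffel symbols of the first kind of a pulled back form. -/
theorem christoffelFirst_comp {g : E → E →L[ℝ] E →L[ℝ] ℝ} {h : F → F →L[ℝ] F →L[ℝ] ℝ} {u : F → E}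
    {y : F} (hg : DifferentiableAt ℝ g (u y)) (hsymm : ∀ x v w, g x v w = g x w v)
    (hu : ContDiffAt ℝ ∞ u y)
    (hgh : h =ᶠ[nhds y] fun x ↦ (g (u x)).bilinearComp (fderiv ℝ u x) (fderiv ℝ u x))
    (v w z : F) :
    christoffelFirst h y v w z =
      g (u y) (fderiv ℝ (fderiv ℝ u) y v w) (fderiv ℝ u y z) +
        christoffelFirst g (u y) (fderiv ℝ u y v) (fderiv ℝ u y w) (fderiv ℝ u y z) := by
  have hu' : DifferentiableAt ℝ (fderiv ℝ u) y :=
    (hu.fderiv_right (m := ∞) le_rfl).differentiableAt (by simp)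
  have hud : DifferentiableAt ℝ u y := hu.differentiableAt (by simp)
  have hgu : HasFDerivAt (fun x ↦ g (u x)) ((fderiv ℝ g (u y)).comp (fderiv ℝ u y)) y :=
    hg.hasFDerivAt.comp y hud.hasFDerivAt
  have happ (b : F) : HasFDerivAt (fun x ↦ fderiv ℝ u x b) ((fderiv ℝ (fderiv ℝ u) y).flip b) y := by
    simpa using hu'.hasFDerivAt.clm_apply (hasFDerivAt_const b y)
  have key (a b c : F) : fderiv ℝ h y a b c =
      fderiv ℝ g (u y) (fderiv ℝ u y a) (fderiv ℝ u y b) (fderiv ℝ u y c) +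
      g (u y) (fderiv ℝ (fderiv ℝ u) y a b) (fderiv ℝ u y c) +
      g (u y) (fderiv ℝ u y b) (fderiv ℝ (fderiv ℝ u) y a c) := by
    have hd := (hgu.clm_apply (happ b)).clm_apply (happ c)
    have hh : DifferentiableAt ℝ h y := by
      refine DifferentiableAt.congr_of_eventuallyEq ?_ hgh
      exact ((((ContinuousLinearMap.compL ℝ F E ℝ).flip.differentiableAt.comp y hu').clm_comp
        (hgu.differentiableAt.clm_comp hu') : _))
    have hhbc : HasFDerivAt (fun x ↦ h x b c) (((fderiv ℝ h y).flip b).flip c) y := by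
      have h1 := (hh.hasFDerivAt.clm_apply (hasFDerivAt_const b y)).clm_apply
        (hasFDerivAt_const c y)
      simpa using h1
    have hev : (fun x ↦ h x b c) =ᶠ[nhds y] fun x ↦ g (u x) (fderiv ℝ u x b) (fderiv ℝ u x c) := by
      filter_upwards [hgh] with x hx
      rw [hx]; rfl
    have := congrArg (fun L ↦ L a) (hhbc.unique (hd.congr_of_eventuallyEq hev))
    simp at this
    rw [this]
    ring
  have hsym2 (a b : F) : fderiv ℝ (fderiv ℝ u) y a b = fderiv ℝ (fderiv ℝ u) y b a :=
    (hu.isSymmSndFDerivAt (by simpa using WithTop.coe_le_coe.mpr (le_top : (2 : ℕ∞) ≤ ⊤))) a b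
  -- By symmetry of `D²u` and of `g`, four of the six second-derivative terms cancel in pairs; the
  -- other two are equal and absorb the factor `1/2`.
  rw [christoffelFirst_apply, christoffelFirst_apply, key, key, key, hsym2 w v, hsym2 z v, hsym2 z w,
    hsymm _ (fderiv ℝ (fderiv ℝ u) y v z)]
  ring

end Calculus

/-- A basis of `E` identifies an operator with the finite tuple of its values. Used twice, this
reduces a bilinear form to its scalar components. -/
theorem differentiableAt_of_forall_apply {D E F : Type*} [NormedAddCommGroup D] [NormedSpace ℝ D]
    [NormedAddCommGroup E] [NormedSpace ℝ E] [FiniteDimensional ℝ E] [NormedAddCommGroup F]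
    [NormedSpace ℝ F] {f : D → E →L[ℝ] F} {x : D}
    (h : ∀ v, DifferentiableAt ℝ (fun y ↦ f y v) x) : DifferentiableAt ℝ f x := by
  have hd : Module.finrank ℝ E = Module.finrank ℝ (Fin (Module.finrank ℝ E) → ℝ) :=
    (Module.finrank_fin_fun ℝ).symm
  let e₁ := ContinuousLinearEquiv.ofFinrankEq hd
  let e₂ := (e₁.arrowCongr (1 : F ≃L[ℝ] F)).trans
    (ContinuousLinearEquiv.piRing (Fin (Module.finrank ℝ E)))
  rw [← e₂.comp_differentiableAt_iff]
  exact differentiableAt_pi.mpr fun i ↦ h _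

/-! ### Maps and bilinear forms in preferred charts -/

section Manifold

variable {E : Type*} [NormedAddCommGroup E] [NormedSpace ℝ E]
  {M : Type*} [TopologicalSpace M] [ChartedSpace E M]
  {F : Type*} [NormedAddCommGroup F] [NormedSpace ℝ F]
  {N : Type*} [TopologicalSpace N] [ChartedSpace F N]
  {F' : Type*} [NormedAddCommGroup F'] [NormedSpace ℝ F']
  {N' : Type*} [TopologicalSpace N'] [ChartedSpace F' N']

/-- A map between manifolds in the preferred charts. -/
abbrev inCharts (u : N → M) (x : N) : F → E :=
  extChartAt 𝓘(ℝ, E) (u x) ∘ u ∘ (extChartAt 𝓘(ℝ, F) x).symm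

theorem inCharts_apply_self (u : N → M) (x : N) :
    inCharts (E := E) (F := F) u x (extChartAt 𝓘(ℝ, F) x x) = extChartAt 𝓘(ℝ, E) (u x) (u x) := by
  simp [inCharts]

theorem contDiffAt_inCharts {u : N → M} {x : N} (hu : ContMDiffAt 𝓘(ℝ, F) 𝓘(ℝ, E) ∞ u x) :
    ContDiffAt ℝ ∞ (inCharts (E := E) (F := F) u x) (extChartAt 𝓘(ℝ, F) x x) := by
  have h := (contMDiffAt_iff.mp hu).2
  simp only [modelWithCornersSelf_coe, Set.range_id, contDiffWithinAt_univ] at h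
  exact h

theorem mfderiv_eq_fderiv_inCharts {u : N → M} {x : N}
    (hu : ContMDiffAt 𝓘(ℝ, F) 𝓘(ℝ, E) ∞ u x) :
    (mfderiv 𝓘(ℝ, F) 𝓘(ℝ, E) u x : F →L[ℝ] E) =
      fderiv ℝ (inCharts (E := E) (F := F) u x) (extChartAt 𝓘(ℝ, F) x x) := by
  have h := (hu.mdifferentiableAt (by simp)).mfderiv
  simp only [modelWithCornersSelf_coe, Set.range_id, fderivWithin_univ] at h
  exact h

theorem eventually_extChartAt_symm_comp {u : N → M} {x : N} (hu : ContinuousAt u x) :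
    ∀ᶠ y in nhds (extChartAt 𝓘(ℝ, F) x x),
      u ((extChartAt 𝓘(ℝ, F) x).symm y) ∈ (extChartAt 𝓘(ℝ, E) (u x)).source := by
  have hc : ContinuousAt (u ∘ (extChartAt 𝓘(ℝ, F) x).symm) (extChartAt 𝓘(ℝ, F) x x) := by
    apply ContinuousAt.comp
    · rwa [extChartAt_to_inv]
    · exact continuousAt_extChartAt_symm x
  apply hc.eventually
  simpa using extChartAt_source_mem_nhds (I := 𝓘(ℝ, E)) (u x)

/-- Composition of maps in charts. -/
theorem inCharts_comp {f : N → M} {u : N' → N} {x : N'} (hu : ContinuousAt u x) :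
    inCharts (E := E) (F := F') (f ∘ u) x =ᶠ[nhds (extChartAt 𝓘(ℝ, F') x x)]
      inCharts (E := E) (F := F) f (u x) ∘ inCharts (E := F) (F := F') u x := by
  filter_upwards [eventually_extChartAt_symm_comp (E := F) (F := F') hu] with y hy
  simp only [inCharts, Function.comp_apply]
  rw [PartialEquiv.left_inv _ hy]

theorem pullback_pullback {g : BilinearField E M} {f : N → M} {u : N' → N} {x : N'}
    (hf : MDifferentiableAt 𝓘(ℝ, F) 𝓘(ℝ, E) f (u x))
    (hu : MDifferentiableAt 𝓘(ℝ, F') 𝓘(ℝ, F) u x) :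
    pullback (F := F') (pullback (F := F) g f) u x = pullback (F := F') g (f ∘ u) x := by
  ext v w
  simp only [pullback_apply, mfderiv_comp x hf hu]
  rfl

theorem pullback_congr {g : BilinearField E M} {u u' : N → M} {x : N} (h : u =ᶠ[nhds x] u') :
    pullback (F := F) g u x = pullback (F := F) g u' x := by
  have h1 : (mfderiv 𝓘(ℝ, F) 𝓘(ℝ, E) u x : F →L[ℝ] E) = mfderiv 𝓘(ℝ, F) 𝓘(ℝ, E) u' x :=
    h.mfderiv_eq
  ext v w
  change (g (u x) : E →L[ℝ] E →L[ℝ] ℝ) ((mfderiv 𝓘(ℝ, F) 𝓘(ℝ, E) u x : F →L[ℝ] E) v)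
    ((mfderiv 𝓘(ℝ, F) 𝓘(ℝ, E) u x : F →L[ℝ] E) w) =
    (g (u' x) : E →L[ℝ] E →L[ℝ] ℝ) ((mfderiv 𝓘(ℝ, F) 𝓘(ℝ, E) u' x : F →L[ℝ] E) v)
    ((mfderiv 𝓘(ℝ, F) 𝓘(ℝ, E) u' x : F →L[ℝ] E) w)
  rw [h1, h.eq_of_nhds]

section Smooth

variable [IsManifold 𝓘(ℝ, E) ∞ M] [IsManifold 𝓘(ℝ, F) ∞ N]

theorem contMDiffAt_extChartAt_symm (x₀ : M) {y : E} (hy : y ∈ (extChartAt 𝓘(ℝ, E) x₀).target) :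
    ContMDiffAt 𝓘(ℝ, E) 𝓘(ℝ, E) ∞ (extChartAt 𝓘(ℝ, E) x₀).symm y :=
  (contMDiffOn_extChartAt_symm (I := 𝓘(ℝ, E)) (n := ∞) x₀).contMDiffAt
    ((isOpen_extChartAt_target x₀).mem_nhds hy)

/-- The components of a form at the centre of the chart. -/
theorem formInChart_self (g : BilinearField E M) (x : M) :
    formInChart g x (extChartAt 𝓘(ℝ, E) x x) = g x := by
  have : IsManifold 𝓘(ℝ, E) 1 M := .of_le (n := ∞) (mod_cast le_top)
  have h := mfderivWithin_range_extChartAt_symm (I := 𝓘(ℝ, E)) (x := x)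
  simp only [modelWithCornersSelf_coe, Set.range_id, mfderivWithin_univ] at h
  have h1 : (mfderiv 𝓘(ℝ, E) 𝓘(ℝ, E) (extChartAt 𝓘(ℝ, E) x).symm (extChartAt 𝓘(ℝ, E) x x) :
    E →L[ℝ] E) = ContinuousLinearMap.id ℝ E := h
  ext v w
  change (g ((extChartAt 𝓘(ℝ, E) x).symm (extChartAt 𝓘(ℝ, E) x x)) : E →L[ℝ] E →L[ℝ] ℝ)
    ((mfderiv 𝓘(ℝ, E) 𝓘(ℝ, E) (extChartAt 𝓘(ℝ, E) x).symm (extChartAt 𝓘(ℝ, E) x x) :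
      E →L[ℝ] E) v)
    ((mfderiv 𝓘(ℝ, E) 𝓘(ℝ, E) (extChartAt 𝓘(ℝ, E) x).symm (extChartAt 𝓘(ℝ, E) x x) :
      E →L[ℝ] E) w) = (g x : E →L[ℝ] E →L[ℝ] ℝ) v w
  rw [h1, extChartAt_to_inv]
  rfl

/-- The components of a pulled back form. -/
theorem formInChart_pullback (g : BilinearField E M) {u : N → M}
    (hu : ContMDiff 𝓘(ℝ, F) 𝓘(ℝ, E) ∞ u) (x : N) :
    formInChart (pullback (F := F) g u) x =ᶠ[nhds (extChartAt 𝓘(ℝ, F) x x)] fun y ↦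
      (formInChart g (u x) (inCharts (E := E) (F := F) u x y)).bilinearComp
        (fderiv ℝ (inCharts (E := E) (F := F) u x) y)
        (fderiv ℝ (inCharts (E := E) (F := F) u x) y) := by
  have h1 := (eventually_extChartAt_symm_comp (E := E) (F := F) hu.continuous.continuousAt
    (x := x)).eventually_nhds
  have h2 := ((contDiffAt_inCharts (hu x)).of_le (m := 1) (mod_cast le_top)).eventually (by simp)
  filter_upwards [h1, h2, extChartAt_target_mem_nhds x] with y hy hyd hyt
  have hs := contMDiffAt_extChartAt_symm (E := F) x hyt
  have hs' := contMDiffAt_extChartAt_symm (E := E) (u x)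
    ((extChartAt 𝓘(ℝ, E) (u x)).map_source hy.self_of_nhds)
  -- Both sides are the same map into `M` near `y`, so pulling `g` back along either factorization
  -- gives the same form.
  have hev : u ∘ (extChartAt 𝓘(ℝ, F) x).symm =ᶠ[nhds y]
      (extChartAt 𝓘(ℝ, E) (u x)).symm ∘ inCharts (E := E) (F := F) u x := by
    filter_upwards [hy] with z hz
    simp only [inCharts, Function.comp_apply]
    rw [PartialEquiv.left_inv _ hz]
  have hyd' : MDifferentiableAt 𝓘(ℝ, F) 𝓘(ℝ, E) (inCharts (E := E) (F := F) u x) y :=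
    (hyd.differentiableAt (by simp)).mdifferentiableAt
  have h3 : (mfderiv 𝓘(ℝ, F) 𝓘(ℝ, E) (inCharts (E := E) (F := F) u x) y : F →L[ℝ] E) =
      fderiv ℝ (inCharts (E := E) (F := F) u x) y := mfderiv_eq_fderiv
  have h4 := pullback_pullback (g := g) (f := u) (hu.mdifferentiableAt (by simp))
    (hs.mdifferentiableAt (by simp))
  have h5 := pullback_congr (N := F) (F := F) (g := g) hev
  have h6 := pullback_pullback (g := g) (f := (extChartAt 𝓘(ℝ, E) (u x)).symm) (N' := F) (x := y)
    (u := inCharts (E := E) (F := F) u x)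
    (F := E) (F' := F) (hs'.mdifferentiableAt (by simp)) hyd'
  have h7 : pullback (F := F) (formInChart g (u x)) (inCharts (E := E) (F := F) u x) y =
      (formInChart g (u x) (inCharts (E := E) (F := F) u x y)).bilinearComp
        (fderiv ℝ (inCharts (E := E) (F := F) u x) y)
        (fderiv ℝ (inCharts (E := E) (F := F) u x) y) := by
    rw [← h3]
    rfl
  exact (h4.trans (h5.trans h6.symm)).trans h7

/-- The components of a smooth form are differentiable. -/
theorem differentiableAt_formInChart [FiniteDimensional ℝ E] {g : BilinearField E M}
    (hg : ContMDiff 𝓘(ℝ, E) (𝓘(ℝ, E).prod 𝓘(ℝ, E →L[ℝ] E →L[ℝ] ℝ)) ∞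
      (fun x ↦ Bundle.TotalSpace.mk' (E →L[ℝ] E →L[ℝ] ℝ)
        (E := fun x : M ↦ TangentSpace 𝓘(ℝ, E) x →L[ℝ] TangentSpace 𝓘(ℝ, E) x →L[ℝ] ℝ) x (g x)))
    (x : M) : DifferentiableAt ℝ (formInChart g x) (extChartAt 𝓘(ℝ, E) x x) := by
  have : IsManifold 𝓘(ℝ, E) 1 M := .of_le (n := ∞) (mod_cast le_top)
  have hs := contMDiffAt_extChartAt_symm x (mem_extChartAt_target (I := 𝓘(ℝ, E)) x)
  have hsec (v : E) : ContMDiffAt 𝓘(ℝ, E) (𝓘(ℝ, E).prod 𝓘(ℝ, E)) ∞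
      (fun y ↦ Bundle.TotalSpace.mk' E (E := fun x : M ↦ TangentSpace 𝓘(ℝ, E) x)
        ((extChartAt 𝓘(ℝ, E) x).symm y)
        (mfderiv 𝓘(ℝ, E) 𝓘(ℝ, E) (extChartAt 𝓘(ℝ, E) x).symm y v)) (extChartAt 𝓘(ℝ, E) x x) := by
    rw [Bundle.contMDiffAt_totalSpace]
    refine ⟨hs, (contMDiffAt_const (c := v)).congr_of_eventuallyEq ?_⟩
    filter_upwards [extChartAt_target_mem_nhds x] with y hy
    have hy' := (extChartAt 𝓘(ℝ, E) x).map_target hy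
    rw [extChartAt_source] at hy'
    -- The bundle trivialization is the differential of the chart, inverse to that of the inverse
    -- chart; the coordinate field therefore has the constant component `v`.
    have h1 := TangentBundle.continuousLinearMapAt_trivializationAt (I := 𝓘(ℝ, E)) hy'
    have h2 := mfderiv_extChartAt_comp_mfderivWithin_extChartAt_symm (I := 𝓘(ℝ, E)) hy
    simp only [modelWithCornersSelf_coe, Set.range_id, mfderivWithin_univ] at h2
    simp only [Bundle.TotalSpace.mk', extChartAt_to_inv]
    rw [← Bundle.Trivialization.continuousLinearMapAt_apply_of_mem (R := ℝ) _ (by simpa using hy'), h1]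
    exact congrArg (fun L ↦ L v) h2
  refine differentiableAt_of_forall_apply fun v ↦ differentiableAt_of_forall_apply fun w ↦ ?_
  have h := ((hg.contMDiffAt (x := (extChartAt 𝓘(ℝ, E) x).symm (extChartAt 𝓘(ℝ, E) x x))).comp
    (extChartAt 𝓘(ℝ, E) x x) hs).clm_bundle_apply₂ (F₁ := E) (F₂ := E) (F₃ := ℝ)
    (E₃ := Bundle.Trivial M ℝ) (hsec v) (hsec w)
  rw [Bundle.contMDiffAt_totalSpace] at h
  exact (h.2.contDiffAt).differentiableAt (by simp)

end Smooth

end Manifold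

/-! ### Second fundamental form and totally geodesic hypersurfaces -/

section Immersion

variable {E : Type*} [NormedAddCommGroup E] [NormedSpace ℝ E]
  {M : Type*} [TopologicalSpace M] [ChartedSpace E M]
  {F : Type*} [NormedAddCommGroup F] [NormedSpace ℝ F]
  {N : Type*} [TopologicalSpace N] [ChartedSpace F N]
  {F' : Type*} [NormedAddCommGroup F'] [NormedSpace ℝ F']
  {N' : Type*} [TopologicalSpace N'] [ChartedSpace F' N']

/-- The differential of a map between manifolds, in terms of the model spaces. -/
abbrev differential (u : N → M) (x : N) : F →L[ℝ] E := mfderiv 𝓘(ℝ, F) 𝓘(ℝ, E) u x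

theorem secondFundamentalForm_eq (g : BilinearField E M) (u : N → M) (x : N) (v w : F) :
    secondFundamentalForm (F := F) g u x v w =
      (covSecondDeriv (F := F) g u x v w -
        differential (E := E) u x (christoffelAt (pullback (F := F) g u) x v w) : E) := rfl

theorem covSecondDeriv_eq (g : BilinearField E M) {u : N → M} {x : N}
    (hu : ContMDiffAt 𝓘(ℝ, F) 𝓘(ℝ, E) ∞ u x) (v w : F) :
    covSecondDeriv (F := F) g u x v w =
      fderiv ℝ (fderiv ℝ (inCharts (E := E) (F := F) u x)) (extChartAt 𝓘(ℝ, F) x x) v w +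
        christoffelAt g (u x) (differential (E := E) (F := F) u x v)
          (differential (E := E) (F := F) u x w) := by
  rw [differential, mfderiv_eq_fderiv_inCharts hu]
  rfl

theorem hessian_eq (g : BilinearField E M) (f : M → ℝ) (x : M) (v w : E) :
    (hessian g f x : E →L[ℝ] E →L[ℝ] ℝ) v w =
      fderiv ℝ (fderiv ℝ (f ∘ (extChartAt 𝓘(ℝ, E) x).symm)) (extChartAt 𝓘(ℝ, E) x x) v w -
        fderiv ℝ (f ∘ (extChartAt 𝓘(ℝ, E) x).symm) (extChartAt 𝓘(ℝ, E) x x)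
          (christoffelAt g x v w) := rfl

/-- The second derivative of `f ∘ u` at `x` in the preferred chart. -/
theorem fderiv_fderiv_comp_inCharts (g : BilinearField E M) {f : M → ℝ} {u : N → M} {x : N}
    (hf : ContMDiffAt 𝓘(ℝ, E) 𝓘(ℝ, ℝ) ∞ f (u x)) (hu : ContMDiffAt 𝓘(ℝ, F) 𝓘(ℝ, E) ∞ u x)
    (v w : F) :
    fderiv ℝ (fderiv ℝ ((f ∘ u) ∘ (extChartAt 𝓘(ℝ, F) x).symm)) (extChartAt 𝓘(ℝ, F) x x) v w =
      (hessian g f (u x) : E →L[ℝ] E →L[ℝ] ℝ) (differential (E := E) (F := F) u x v)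
          (differential (E := E) (F := F) u x w) +
        differential (E := ℝ) (F := E) f (u x) (covSecondDeriv (F := F) g u x v w) := by
  have hev := inCharts_comp (E := ℝ) (F := E) (F' := F) (f := f) hu.continuousAt
  have hfc := contDiffAt_inCharts hf
  rw [← inCharts_apply_self (F := F) u x] at hfc
  have h := fderiv_fderiv_comp hfc (contDiffAt_inCharts hu) v w
  rw [← hev.fderiv.fderiv_eq, inCharts_apply_self] at h
  -- The Christoffel terms of `g` in the Hessian and in the covariant derivative cancel.
  rw [hessian_eq, covSecondDeriv_eq g hu, map_add, differential, differential,
    mfderiv_eq_fderiv_inCharts hu, mfderiv_eq_fderiv_inCharts hf]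
  simp only [inCharts, extChartAt_model_space_eq_id, PartialEquiv.refl_coe,
    Function.id_comp] at h ⊢
  rw [h]
  ring

/-- The derivative of `d(f ∘ u)` along `f ∘ u`. -/
theorem covSecondDeriv_comp (g : BilinearField E M) (h : BilinearField F N) {f : N → M}
    {u : N' → N} {x : N'} (hf : ContMDiffAt 𝓘(ℝ, F) 𝓘(ℝ, E) ∞ f (u x))
    (hu : ContMDiffAt 𝓘(ℝ, F') 𝓘(ℝ, F) ∞ u x) (v w : F') :
    covSecondDeriv (F := F') g (f ∘ u) x v w =
      covSecondDeriv (F := F) g f (u x) (differential (E := F) (F := F') u x v)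
          (differential (E := F) (F := F') u x w) -
        differential (E := E) (F := F) f (u x) (christoffelAt h (u x)
          (differential (E := F) (F := F') u x v) (differential (E := F) (F := F') u x w)) +
        differential (E := E) (F := F) f (u x) (covSecondDeriv (F := F') h u x v w) := by
  have hev := inCharts_comp (E := E) (F := F) (F' := F') (f := f) hu.continuousAt
  have hfc := contDiffAt_inCharts hf
  rw [← inCharts_apply_self (F := F') u x] at hfc
  have hh := fderiv_fderiv_comp hfc (contDiffAt_inCharts hu) v w
  rw [← hev.fderiv.fderiv_eq, inCharts_apply_self, ← mfderiv_eq_fderiv_inCharts hf,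
    ← mfderiv_eq_fderiv_inCharts hu] at hh
  have hd (a : F') : differential (E := E) (F := F') (f ∘ u) x a =
      differential (E := E) (F := F) f (u x) (differential (E := F) (F := F') u x a) := by
    rw [differential, mfderiv_comp x (hf.mdifferentiableAt (by simp))
      (hu.mdifferentiableAt (by simp))]
    rfl
  -- The Christoffel symbols of `h` occur twice with opposite signs, so `h` may be arbitrary.
  rw [covSecondDeriv_eq g (hf.comp x hu), covSecondDeriv_eq g hf, covSecondDeriv_eq h hu, hh, hd,
    hd, map_add]
  simp only [Function.comp_apply]
  abel

variable [IsManifold 𝓘(ℝ, E) ∞ M] [IsManifold 𝓘(ℝ, F) ∞ N] [FiniteDimensional ℝ E]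
  [FiniteDimensional ℝ F]

/-- The second fundamental form takes values in the normal space. -/
theorem secondFundamentalForm_orthogonal {g : BilinearField E M}
    (hg : ContMDiff 𝓘(ℝ, E) (𝓘(ℝ, E).prod 𝓘(ℝ, E →L[ℝ] E →L[ℝ] ℝ)) ∞
      (fun x ↦ Bundle.TotalSpace.mk' (E →L[ℝ] E →L[ℝ] ℝ)
        (E := fun x : M ↦ TangentSpace 𝓘(ℝ, E) x →L[ℝ] TangentSpace 𝓘(ℝ, E) x →L[ℝ] ℝ) x (g x)))
    (hsymm : ∀ (x : M) (v w : E), (g x : E →L[ℝ] E →L[ℝ] ℝ) v w = (g x : E →L[ℝ] E →L[ℝ] ℝ) w v)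
    (hnd : ∀ (x : M) (v : E), (∀ w : E, (g x : E →L[ℝ] E →L[ℝ] ℝ) v w = 0) → v = 0)
    {u : N → M} (hu : IsSpacelikeImmersion (F := F) g u) (x : N) (v w z : F) :
    (g (u x) : E →L[ℝ] E →L[ℝ] ℝ) (secondFundamentalForm (F := F) g u x v w : E)
      (differential (E := E) u x z) = 0 := by
  have hux := hu.smooth x
  have hG := formInChart_self g (u x)
  have hH := formInChart_self (pullback (F := F) g u) x
  have hd := differentiableAt_formInChart hg (u x)
  rw [← inCharts_apply_self (F := F) u x] at hd
  have key := christoffelFirst_comp hd (fun y a b ↦ hsymm _ _ _) (contDiffAt_inCharts hux)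
    (formInChart_pullback g hu.smooth x) v w z
  rw [inCharts_apply_self, hG, ← mfderiv_eq_fderiv_inCharts hux] at key
  have hndG : ∀ a, (∀ b, formInChart g (u x) (extChartAt 𝓘(ℝ, E) (u x) (u x)) a b = 0) → a = 0 := by
    rw [hG]
    exact hnd _
  have hndH : ∀ a, (∀ b, formInChart (pullback (F := F) g u) x (extChartAt 𝓘(ℝ, F) x x) a b = 0) →
      a = 0 := by
    rw [hH]
    intro a ha
    by_contra ha0
    exact (hu.pos x a ha0).ne' (ha a)
  rw [← apply_christoffel hndG, ← apply_christoffel hndH, hG, hH] at key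
  have hadd (B : E →L[ℝ] E →L[ℝ] ℝ) (a b c d : E) : B (a + b - c) d = B a d + B b d - B c d := by
    simp
  rw [secondFundamentalForm_eq, covSecondDeriv_eq g hux]
  exact (hadd _ _ _ _ _).trans (sub_eq_zero.mpr key.symm)

/-- A spacelike hypersurface of a Lorentzian manifold with `K = 0` is totally geodesic. -/
theorem secondFundamentalForm_eq_zero (g : LorentzianMetric E M) {u : N → M}
    (hu : IsSpacelikeImmersion (F := F) g.form u)
    (hdim : Module.finrank ℝ E = Module.finrank ℝ F + 1)
    (hK : ∀ (x : N) (ν : TangentSpace 𝓘(ℝ, E) (u x)),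
      IsUnitTimelikeNormal (F := F) g.form u x ν →
      ∀ v w : TangentSpace 𝓘(ℝ, F) x, extrinsicCurvature g.form u x ν v w = 0)
    (x : N) (v w : F) : (secondFundamentalForm (F := F) g.form u x v w : E) = 0 := by
  by_contra h0
  have horth := secondFundamentalForm_orthogonal g.contMDiff (fun y ↦ (g.isLorentzian y).symm)
    (fun y a ha ↦ (g.isLorentzian y).eq_zero_of_apply_eq_zero (E := E) ha) hu x v w
  set B : E →L[ℝ] E →L[ℝ] ℝ := g.form (u x)
  set A : E := secondFundamentalForm (F := F) g.form u x v w
  have hpos : ∀ z : F, z ≠ 0 →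
      0 < B (differential (E := E) u x z) (differential (E := E) u x z) := hu.pos x
  have hB : IsLorentzian (V := E) B := g.isLorentzian (u x)
  have hneg : B A A < 0 := hB.neg_of_orthogonal hpos hdim h0 horth
  have hsq : 0 < √(-B A A) := Real.sqrt_pos.mpr (by linarith)
  have hsq' : √(-B A A) * √(-B A A) = -B A A := Real.mul_self_sqrt (by linarith)
  -- The second fundamental form, once normalized, is itself an admissible normal for `hK`.
  have hν : IsUnitTimelikeNormal (F := F) g.form u x ((√(-B A A))⁻¹ • A : E) := by
    constructor
    · intro z
      change B ((√(-B A A))⁻¹ • A) (differential (E := E) (F := F) u x z) = 0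
      rw [map_smul, smul_apply, smul_eq_mul]
      exact mul_eq_zero_of_right _ (horth z)
    · change B ((√(-B A A))⁻¹ • A) ((√(-B A A))⁻¹ • A) = -1
      simp only [map_smul, smul_apply, smul_eq_mul]
      field_simp
      rw [pow_two, hsq']
      ring
  have hk := hK x _ hν v w
  have hc : B ((√(-B A A))⁻¹ • A) (covSecondDeriv (F := F) g.form u x v w : E) = 0 :=
    neg_eq_zero.mp hk
  rw [map_smul, smul_apply, smul_eq_mul] at hc
  have hc' : B A (covSecondDeriv (F := F) g.form u x v w : E) = 0 :=
    (mul_eq_zero.mp hc).resolve_left (inv_ne_zero hsq.ne')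
  -- `K` only controls the pairing with `∇_v (du w)`; the remaining part of `A` is tangential, hence
  -- orthogonal to `A`.
  have : B A A = 0 := by
    conv_lhs => rw [show B A A = B A (covSecondDeriv (F := F) g.form u x v w -
      differential (E := E) u x (christoffelAt (pullback (F := F) g.form u) x v w)) from rfl]
    rw [map_sub, hc', zero_sub, neg_eq_zero]
    exact horth _
  exact hneg.ne this

end Immersion

/-! ### Second derivatives at maxima and of periodic functions -/

section SecondDerivativeTest

/-- The second derivative is nonpositive at a local maximum. -/
theorem _root_.IsLocalMax.deriv_deriv_nonpos {f : ℝ → ℝ} {t : ℝ} (h : IsLocalMax f t)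
    (hc : ContinuousAt f t) : deriv (deriv f) t ≤ 0 := by
  by_contra! hpos
  -- A point that is both a local maximum and a local minimum has a locally constant function around
  -- it.
  have hmin := isLocalMin_of_deriv_deriv_pos hpos h.deriv_eq_zero hc
  have hev : f =ᶠ[nhds t] fun _ ↦ f t := by
    filter_upwards [h, hmin] with s h1 h2 using le_antisymm h1 h2
  have : deriv (deriv f) t = 0 := by
    rw [hev.deriv.deriv_eq]
    simp
  exact hpos.ne' this

/-- Restriction to the line through `y` in direction `v` reduces to one variable: the line has zero
second derivative, so the chain rule leaves only `D²f(v, v)`. -/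
theorem _root_.IsLocalMax.fderiv_fderiv_nonpos {F : Type*} [NormedAddCommGroup F] [NormedSpace ℝ F]
    {f : F → ℝ} {y : F} (h : IsLocalMax f y) (hf : ContDiffAt ℝ ∞ f y) (v : F) :
    fderiv ℝ (fderiv ℝ f) y v v ≤ 0 := by
  have hl : ContDiff ℝ ∞ fun t : ℝ ↦ y + t • v := by fun_prop
  have hd (t : ℝ) : fderiv ℝ (fun t : ℝ ↦ y + t • v) t 1 = v := by
    have : HasDerivAt (fun t : ℝ ↦ y + t • v) ((1 : ℝ) • v) t :=
      ((hasDerivAt_id t).smul_const v).const_add y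
    simpa using this.deriv
  have hy : y + (0 : ℝ) • v = y := by simp
  have hcont : ContinuousAt (fun t : ℝ ↦ y + t • v) 0 := hl.continuous.continuousAt
  have hf' : ContDiffAt ℝ ∞ f ((fun t : ℝ ↦ y + t • v) 0) := by simpa using hf
  have hmax : IsLocalMax (f ∘ fun t : ℝ ↦ y + t • v) 0 := by
    apply IsLocalMax.comp_continuous _ hcont
    simpa using h
  have h1 := hmax.deriv_deriv_nonpos
    (ContinuousAt.comp (f := fun t : ℝ ↦ y + t • v) hf'.continuousAt hcont)
  have h2 := fderiv_fderiv_comp (u := fun t : ℝ ↦ y + t • v) hf' hl.contDiffAt 1 1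
  have h3 : fderiv ℝ (fderiv ℝ fun t : ℝ ↦ y + t • v) 0 1 1 = 0 := by
    have : DifferentiableAt ℝ (fderiv ℝ fun t : ℝ ↦ y + t • v) 0 :=
      (hl.contDiffAt.fderiv_right (m := ∞) le_rfl).differentiableAt (by simp)
    have h4 := (this.hasFDerivAt.clm_apply (hasFDerivAt_const (1 : ℝ) (0 : ℝ))).fderiv
    have h5 : (fun t : ℝ ↦ fderiv ℝ (fun t : ℝ ↦ y + t • v) t 1) = fun _ ↦ v := funext hd
    rw [h5] at h4
    simpa using (congrArg (fun L ↦ L (1 : ℝ)) h4).symm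
  have h6 : deriv (deriv (f ∘ fun t : ℝ ↦ y + t • v)) 0 =
      fderiv ℝ (fderiv ℝ (f ∘ fun t : ℝ ↦ y + t • v)) 0 1 1 := by
    have hcd : ContDiffAt ℝ ∞ (f ∘ fun t : ℝ ↦ y + t • v) 0 := hf'.comp 0 hl.contDiffAt
    have : DifferentiableAt ℝ (fderiv ℝ (f ∘ fun t : ℝ ↦ y + t • v)) 0 :=
      (hcd.fderiv_right (m := ∞) le_rfl).differentiableAt (by simp)
    have h4 := (this.hasFDerivAt.clm_apply (hasFDerivAt_const (1 : ℝ) (0 : ℝ))).fderiv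
    simpa using congrArg (fun L ↦ L (1 : ℝ)) h4
  rw [h6, h2, h3, hd] at h1
  simpa using h1

/-- A periodic function with nonnegative second derivative is constant. -/
theorem deriv_eq_zero_of_periodic {f : ℝ → ℝ} (hf : ContDiff ℝ ∞ f)
    (hnn : ∀ t, 0 ≤ deriv (deriv f) t) {T : ℝ} (hT : 0 < T) (hper : Function.Periodic f T) (t : ℝ) :
    deriv f t = 0 := by
  have hd : Differentiable ℝ f := hf.differentiable (by simp)
  have hd' : Differentiable ℝ (deriv f) :=
    (hf.iterate_deriv 1).differentiable (by simp)
  have hmono : Monotone (deriv f) := monotone_of_deriv_nonneg hd' hnn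
  have hper' (s : ℝ) : deriv f (s + T) = deriv f s := by
    rw [← deriv_comp_add_const]
    exact congrArg (fun h ↦ deriv h s) (funext hper)
  -- A critical point exists within one period; the monotone derivative has equal values at both
  -- ends, so it is squeezed to zero.
  obtain ⟨c, hc, hc'⟩ := exists_deriv_eq_slope f (lt_add_of_pos_right t hT)
    hd.continuous.continuousOn hd.differentiableOn
  rw [hper t, sub_self, zero_div] at hc'
  have h1 := hmono hc.1.le
  have h2 := hmono hc.2.le
  rw [hper'] at h2
  linarith

end SecondDerivativeTest

/-! ### Curves with zero velocity -/

section Constant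

variable {E : Type*} [NormedAddCommGroup E] [NormedSpace ℝ E]
  {M : Type*} [TopologicalSpace M] [ChartedSpace E M] [IsManifold 𝓘(ℝ, E) ∞ M]

/-- A curve with vanishing velocity is constant. -/
theorem eq_of_differential_eq_zero {γ : ℝ → M} (hγ : ContMDiff 𝓘(ℝ, ℝ) 𝓘(ℝ, E) ∞ γ)
    (h : ∀ t, differential (E := E) γ t (1 : ℝ) = 0) (s t : ℝ) : γ s = γ t := by
  have hloc : IsLocallyConstant γ := by
    rw [IsLocallyConstant.iff_eventually_eq]
    intro t
    have hnhds : γ ⁻¹' (extChartAt 𝓘(ℝ, E) (γ t)).source ∈ nhds t :=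
      hγ.continuous.continuousAt.preimage_mem_nhds (extChartAt_source_mem_nhds (γ t))
    -- On this ball the curve stays in one chart, whose injectivity turns constant coordinates into
    -- a constant point.
    obtain ⟨r, hr, hball⟩ := Metric.mem_nhds_iff.mp hnhds
    have hder : ∀ s ∈ Metric.ball t r,
        HasFDerivAt (extChartAt 𝓘(ℝ, E) (γ t) ∘ γ) (0 : ℝ →L[ℝ] E) s := by
      intro s hs
      have hs' := hball hs
      rw [Set.mem_preimage, extChartAt_source] at hs'
      have : IsManifold 𝓘(ℝ, E) 1 M := .of_le (n := ∞) (mod_cast le_top)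
      have h1 := (hγ.mdifferentiableAt (x := s) (by simp)).hasMFDerivAt
      have h2 := ((mdifferentiableAt_extChartAt (I := 𝓘(ℝ, E)) hs').hasMFDerivAt.comp s h1)
      have h3 : HasFDerivAt (extChartAt 𝓘(ℝ, E) (γ t) ∘ γ)
        ((mfderiv 𝓘(ℝ, E) 𝓘(ℝ, E) (extChartAt 𝓘(ℝ, E) (γ t)) (γ s) : E →L[ℝ] E).comp
          (differential (E := E) γ s : ℝ →L[ℝ] E)) s := h2.hasFDerivAt
      have h4 : (differential (E := E) γ s : ℝ →L[ℝ] E) = 0 := by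
        ext
        exact h s
      have h5 (A : E →L[ℝ] E) {B : ℝ →L[ℝ] E} (hB : B = 0) : A.comp B = 0 := by simp [hB]
      exact h3.congr_fderiv (h5 _ h4)
    filter_upwards [Metric.ball_mem_nhds t hr] with s hs
    have heq := (convex_ball t r).is_const_of_fderivWithin_eq_zero (𝕜 := ℝ)
      (fun x hx ↦ (hder x hx).differentiableAt.differentiableWithinAt)
      (fun x hx ↦ by
        rw [fderivWithin_of_isOpen Metric.isOpen_ball hx, (hder x hx).fderiv])
      hs (Metric.mem_ball_self hr)
    exact (extChartAt 𝓘(ℝ, E) (γ t)).injOn (hball hs) (mem_extChartAt_source (γ t)) heq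
  exact hloc.apply_eq_of_isPreconnected isPreconnected_univ (Set.mem_univ _) (Set.mem_univ _)

end Constant

/-! ### Convexity along totally geodesic submanifolds -/

section Main

variable {E : Type*} [NormedAddCommGroup E] [NormedSpace ℝ E]
  {M : Type*} [TopologicalSpace M] [ChartedSpace E M] [IsManifold 𝓘(ℝ, E) ∞ M]
  {F : Type*} [NormedAddCommGroup F] [NormedSpace ℝ F]
  {N : Type*} [TopologicalSpace N] [ChartedSpace F N]
  {F' : Type*} [NormedAddCommGroup F'] [NormedSpace ℝ F']
  {N' : Type*} [TopologicalSpace N'] [ChartedSpace F' N']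

/-- The Hessian of a spacetime convex function bounds the second derivative of its restriction to
a totally geodesic submanifold, up to first order terms. -/
theorem IsSpacetimeConvex.exists_le_fderiv_fderiv {g : LorentzianMetric E M} {f : M → ℝ}
    (hf : IsSpacetimeConvex g f) {ι : N → M} (hι : ContMDiff 𝓘(ℝ, F) 𝓘(ℝ, E) ∞ ι)
    (hII : ∀ (x : N) (v w : F),
      (secondFundamentalForm (F := F) g.form ι x v w : E) = 0) :
    ∃ c : ℝ, 0 < c ∧ ∀ (u : N' → N), ContMDiff 𝓘(ℝ, F') 𝓘(ℝ, F) ∞ u → ∀ (x : N') (v : F'),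
      c * pullback (F := F') (pullback (F := F) g.form ι) u x v v +
          differential (E := ℝ) (F := F) (f ∘ ι) (u x)
            (covSecondDeriv (F := F') (pullback (F := F) g.form ι) u x v v) ≤
        fderiv ℝ (fderiv ℝ ((f ∘ ι ∘ u) ∘ (extChartAt 𝓘(ℝ, F') x).symm))
          (extChartAt 𝓘(ℝ, F') x x) v v := by
  obtain ⟨c, hc, hbound⟩ := hf.bound
  refine ⟨c, hc, fun u hu x v ↦ ?_⟩
  have hd (a : F') : differential (E := E) (F := F') (ι ∘ u) x a =
      differential (E := E) (F := F) ι (u x) (differential (E := F) (F := F') u x a) := by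
    rw [differential, mfderiv_comp x (hι.mdifferentiableAt (by simp))
      (hu.mdifferentiableAt (by simp))]
    rfl
  have hd' (a : F) : differential (E := ℝ) (F := F) (f ∘ ι) (u x) a =
      differential (E := ℝ) (F := E) f (ι (u x)) (differential (E := E) (F := F) ι (u x) a) := by
    rw [differential, mfderiv_comp (u x) (hf.smooth.mdifferentiableAt (by simp))
      (hι.mdifferentiableAt (by simp))]
    rfl
  have hcov := covSecondDeriv_comp g.form (pullback (F := F) g.form ι) (hι _) (hu x) v v
  have h0 := hII (u x) (differential (E := F) (F := F') u x v)
    (differential (E := F) (F := F') u x v)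
  rw [secondFundamentalForm_eq] at h0
  -- Total geodesy removes the normal component, leaving only the image of the intrinsic derivative
  -- of `u`.
  rw [h0] at hcov
  replace hcov := hcov.trans (zero_add (M := E) _)
  rw [fderiv_fderiv_comp_inCharts g.form (u := ι ∘ u) (hf.smooth _) ((hι _).comp x (hu x)),
    hcov, hd', hd]
  exact add_le_add (hbound _ _) le_rfl

end Main

end SpacetimeConvex

end

/-! ### Exclusion of closed geodesics and closed minimal surfaces -/

theorem mainTheorem6 {n : ℕ}
    {M : Type*} [TopologicalSpace M] [ChartedSpace (EuclideanSpace ℝ (Fin (n + 1))) M]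
    [IsManifold 𝓘(ℝ, EuclideanSpace ℝ (Fin (n + 1))) ∞ M]
    (g : SpacetimeConvex.LorentzianMetric (EuclideanSpace ℝ (Fin (n + 1))) M)
    (f : M → ℝ) (hf : SpacetimeConvex.IsSpacetimeConvex g f)
    {Hyp : Type*} [TopologicalSpace Hyp] [ChartedSpace (EuclideanSpace ℝ (Fin n)) Hyp]
    [IsManifold 𝓘(ℝ, EuclideanSpace ℝ (Fin n)) ∞ Hyp]
    (ι : Hyp → M)
    (hι : SpacetimeConvex.IsSpacelikeImmersion (F := EuclideanSpace ℝ (Fin n)) g.form ι)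
    (hK : ∀ (x : Hyp) (ν : TangentSpace 𝓘(ℝ, EuclideanSpace ℝ (Fin (n + 1))) (ι x)),
      SpacetimeConvex.IsUnitTimelikeNormal (F := EuclideanSpace ℝ (Fin n)) g.form ι x ν →
      ∀ v w : TangentSpace 𝓘(ℝ, EuclideanSpace ℝ (Fin n)) x,
        SpacetimeConvex.extrinsicCurvature g.form ι x ν v w = 0) :
    (∀ γ : ℝ → Hyp, ¬ SpacetimeConvex.IsClosedGeodesic
      (E := EuclideanSpace ℝ (Fin n)) (SpacetimeConvex.pullback g.form ι) γ) ∧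
    (∀ (S : Type*) [TopologicalSpace S] [ChartedSpace (EuclideanSpace ℝ (Fin 2)) S]
      [IsManifold 𝓘(ℝ, EuclideanSpace ℝ (Fin 2)) ∞ S] [CompactSpace S] [Nonempty S]
      (φ : S → Hyp), ¬ SpacetimeConvex.IsMinimalImmersion
        (E := EuclideanSpace ℝ (Fin n)) (F := EuclideanSpace ℝ (Fin 2))
        (SpacetimeConvex.pullback g.form ι) φ) := by
  have hII := SpacetimeConvex.secondFundamentalForm_eq_zero g hι (by simp) hK
  have hpos : ∀ (x : Hyp) (v : EuclideanSpace ℝ (Fin n)), v ≠ 0 →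
    0 < SpacetimeConvex.pullback g.form ι x v v := hι.pos
  have hpos' (x : Hyp) (v : EuclideanSpace ℝ (Fin n)) :
      0 ≤ (SpacetimeConvex.pullback (F := EuclideanSpace ℝ (Fin n)) g.form ι x :
        EuclideanSpace ℝ (Fin n) →L[ℝ] EuclideanSpace ℝ (Fin n) →L[ℝ] ℝ) v v := by
    by_cases h0 : v = 0
    · have h1 (B : EuclideanSpace ℝ (Fin n) →L[ℝ] EuclideanSpace ℝ (Fin n) →L[ℝ] ℝ) :
          0 ≤ B 0 0 := by simp
      rw [h0]
      exact h1 _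
    · exact (hpos x v h0).le
  constructor
  · intro γ hγ
    obtain ⟨c, hc, hle⟩ := hf.exists_le_fderiv_fderiv (F' := ℝ) (N' := ℝ) hι.smooth hII
    obtain ⟨T, hT, hper⟩ := hγ.periodic
    have hsm : ContDiff ℝ ∞ (f ∘ ι ∘ γ) := (hf.smooth.comp (hι.smooth.comp hγ.smooth)).contDiff
    have hle' (t : ℝ) : c * SpacetimeConvex.pullback (F := ℝ) (SpacetimeConvex.pullback
        (F := EuclideanSpace ℝ (Fin n)) g.form ι) γ t (1 : ℝ) (1 : ℝ) ≤
        deriv (deriv (f ∘ ι ∘ γ)) t := by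
      have h1 := hle γ hγ.smooth t 1
      rw [hγ.eqn t, map_zero, add_zero] at h1
      have h2 : deriv (deriv (f ∘ ι ∘ γ)) t = fderiv ℝ (fderiv ℝ (f ∘ ι ∘ γ)) t 1 1 := by
        have : DifferentiableAt ℝ (fderiv ℝ (f ∘ ι ∘ γ)) t :=
          (hsm.contDiffAt.fderiv_right (m := ∞) le_rfl).differentiableAt (by simp)
        have h4 := (this.hasFDerivAt.clm_apply (hasFDerivAt_const (1 : ℝ) t)).fderiv
        simpa using congrArg (fun L ↦ L (1 : ℝ)) h4
      rw [h2]
      simp only [extChartAt_model_space_eq_id, PartialEquiv.refl_symm, PartialEquiv.refl_coe,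
        Function.comp_id, id] at h1
      exact h1
    have hnn (t : ℝ) : 0 ≤ SpacetimeConvex.pullback (F := ℝ) (SpacetimeConvex.pullback
        (F := EuclideanSpace ℝ (Fin n)) g.form ι) γ t (1 : ℝ) (1 : ℝ) := by
      exact hpos' (γ t) (SpacetimeConvex.differential (E := EuclideanSpace ℝ (Fin n)) γ t (1 : ℝ))
    have hz := SpacetimeConvex.deriv_eq_zero_of_periodic hsm
      (fun t ↦ (mul_nonneg hc.le (hnn t)).trans (hle' t)) hT
      (fun t ↦ by simp only [Function.comp_apply, hper t])
    have hvel (t : ℝ) :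
        SpacetimeConvex.differential (E := EuclideanSpace ℝ (Fin n)) γ t (1 : ℝ) = 0 := by
      by_contra h0
      have h1 := hle' t
      -- The second derivative vanishes as well, so a nonzero velocity would give `c h(γ', γ') ≤ 0`.
      rw [funext hz, deriv_const] at h1
      exact absurd h1 (not_le.mpr (mul_pos hc (hpos (γ t) _ h0)))
    obtain ⟨s, t, hst⟩ := hγ.nonconstant
    exact hst (SpacetimeConvex.eq_of_differential_eq_zero hγ.smooth hvel s t)
  · intro S _ _ _ _ _ φ hφ
    obtain ⟨c, hc, hle⟩ := hf.exists_le_fderiv_fderiv (F' := EuclideanSpace ℝ (Fin 2)) (N' := S)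
      hι.smooth hII
    have hsm := hf.smooth.comp (hι.smooth.comp hφ.smooth)
    obtain ⟨x, -, hx⟩ := isCompact_univ.exists_isMaxOn Set.univ_nonempty
      hsm.continuous.continuousOn
    have hmax : IsLocalMax ((f ∘ ι ∘ φ) ∘ (extChartAt 𝓘(ℝ, EuclideanSpace ℝ (Fin 2)) x).symm)
        (extChartAt 𝓘(ℝ, EuclideanSpace ℝ (Fin 2)) x x) := by
      -- The inverse chart takes values in `S` even off its target, so the global maximum gives the
      -- inequality at every `y`.
      refine Filter.Eventually.of_forall fun y ↦ ?_
      simpa using hx (Set.mem_univ _)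
    have hcd := SpacetimeConvex.contDiffAt_inCharts (hsm x)
    simp only [SpacetimeConvex.inCharts, extChartAt_model_space_eq_id, PartialEquiv.refl_coe,
      Function.id_comp] at hcd
    -- At the maximum `d(f ∘ ι)` kills tangent vectors of the surface, hence the tangential
    -- correction separating `∇ dφ` from the second fundamental form.
    have hd0 (a : EuclideanSpace ℝ (Fin 2)) :
        SpacetimeConvex.differential (E := ℝ) (F := EuclideanSpace ℝ (Fin n)) (f ∘ ι) (φ x)
          (SpacetimeConvex.differential (E := EuclideanSpace ℝ (Fin n)) φ x a) = 0 := by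
      have h1 := SpacetimeConvex.mfderiv_eq_fderiv_inCharts (hsm x)
      simp only [SpacetimeConvex.inCharts, extChartAt_model_space_eq_id, PartialEquiv.refl_coe,
        Function.id_comp] at h1
      rw [hmax.fderiv_eq_zero] at h1
      have h2 := mfderiv_comp (g := f ∘ ι) (f := φ) x
        ((hf.smooth.comp hι.smooth).mdifferentiableAt (by simp))
        (hφ.smooth.mdifferentiableAt (by simp))
      exact congrArg (fun L : EuclideanSpace ℝ (Fin 2) →L[ℝ] ℝ ↦ L a) (h2.symm.trans h1)
    let B : EuclideanSpace ℝ (Fin 2) →L[ℝ] EuclideanSpace ℝ (Fin 2) →L[ℝ] ℝ :=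
      SpacetimeConvex.pullback (F := EuclideanSpace ℝ (Fin 2)) (SpacetimeConvex.pullback
        (F := EuclideanSpace ℝ (Fin n)) g.form ι) φ x
    obtain ⟨e, he⟩ := SpacetimeConvex.exists_orthonormal_of_pos
      (ContinuousLinearMap.coeLM ℝ ∘ₗ B.toLinearMap)
      (fun v w ↦ (g.isLorentzian _).symm _ _) (hφ.pos x)
    have hB (i) : B (e i) (e i) = 1 := by simpa using he i i
    let w : Fin (Module.finrank ℝ (EuclideanSpace ℝ (Fin 2))) → EuclideanSpace ℝ (Fin n) := fun i ↦
      SpacetimeConvex.secondFundamentalForm (F := EuclideanSpace ℝ (Fin 2))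
        (SpacetimeConvex.pullback (F := EuclideanSpace ℝ (Fin n)) g.form ι) φ x (e i) (e i)
    have htr : ∑ i, w i = 0 := hφ.trace_eq_zero x e he
    have hi (i) : c + SpacetimeConvex.differential (E := ℝ) (F := EuclideanSpace ℝ (Fin n)) (f ∘ ι)
        (φ x) (w i) ≤ 0 := by
      have h1 := (hle φ hφ.smooth x (e i)).trans (hmax.fderiv_fderiv_nonpos hcd (e i))
      simp only [w]
      rw [SpacetimeConvex.secondFundamentalForm_eq, map_sub, hd0, sub_zero]
      have h2 : c * B (e i) (e i) + _ ≤ 0 := h1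
      rwa [hB, mul_one] at h2
    -- Each of the two unit vectors contributes `c`, and the trace of the second fundamental form
    -- drops out.
    have hsum := Finset.sum_nonpos fun i (_ : i ∈ Finset.univ) ↦ hi i
    rw [Finset.sum_add_distrib, ← map_sum, htr, map_zero, add_zero] at hsum
    simp at hsum
    linarith
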